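/- Let $M$ be a metric space of diameter $\le 1$. Then there exists a complete, $\omega$-homogeneous, Urysohn metric space $L$ containing $M$ as a (metric) subspace such that $M$ is $g$-embedded in $L$ and $w(L)=\max(w(M),\aleph_0)$; in particular $w(L)=w(M)$ whenever $M$ is infinite. Here the weight $w(X)$ of a space $X$ is the least cardinality of a base of its topology. A metric space $L$ is *$\omega$-homogeneous* if every isometry $f:A\to B$ between finite subsets $A,B\subseteq L$ extends to an isometry of $L$ onto itself. A metric space $L$ is *Urysohn* if its diameter is equal to $1$ and, for every finite metric space $F$ of diameter $\le 1$ and every subset $K\subseteq F$, each isometric embedding $K\to L$ extends to an isometric embedding $F\to L$. For a metric space $X$, $\mathrm{Iso}(X)$ is the group of isometries of $X$ onto itself with the topology of pointwise convergence. A subspace $M$ of $L$ is *$g$-embedded* in $L$ if there is a continuous homomorphism $e:\mathrm{Iso}(M)\to\mathrm{Iso}(L)$ such that $e(\varphi)$ extends $\varphi$ for every $\varphi\in\mathrm{Iso}(M)$. -/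

import Mathlib

open Cardinal Topology

universe u v

/-- The weight of a topological space: the least cardinality of a base. -/
noncomputable def topWeight (X : Type u) [TopologicalSpace X] : Cardinal.{u} :=
  sInf {c : Cardinal.{u} |
    ∃ B : Set (Set X), TopologicalSpace.IsTopologicalBasis B ∧ #B = c}

/-- The topology of pointwise convergence on the group `Iso(M)` of isometries of `M` onto
itself. -/
instance isoPointwiseTopology (M : Type u) [MetricSpace M] : TopologicalSpace (M ≃ᵢ M) :=
  TopologicalSpace.induced (fun (φ : M ≃ᵢ M) (x : M) => φ x) Pi.topologicalSpace

/-- `M` is `ω`-homogeneous: every isometry between finite subsets of `M` extends to an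
isometry of `M` onto itself. -/
def IsOmegaHomogeneous (M : Type u) [MetricSpace M] : Prop :=
  ∀ A B : Set M, A.Finite → B.Finite → ∀ f : A ≃ᵢ B, ∃ g : M ≃ᵢ M, ∀ a : A, g a = f a

/-- `M` is Urysohn: its diameter is `1`, and for every finite metric space `F` of diameter `≤ 1`
and every `K ⊆ F`, every isometric embedding `K → M` extends to an isometric embedding
`F → M`. (The diameters are taken in `[0, ∞]`.) -/
def IsUrysohn (M : Type u) [MetricSpace M] : Prop :=
  Metric.ediam (Set.univ : Set M) = 1 ∧
    ∀ (F : Type u) [MetricSpace F] [Finite F], Metric.ediam (Set.univ : Set F) ≤ 1 →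
      ∀ (K : Set F) (f : K → M), Isometry f →
        ∃ g : F → M, Isometry g ∧ ∀ k : K, g k = f k

/-- The isometric embedding `i : M → L` makes `M` a `g`-embedded subspace of `L`: there is a
continuous group homomorphism `e : Iso(M) → Iso(L)` such that, when `M` is identified with its
image under `i`, each `e φ` is an extension of `φ`. -/
def IsGEmbedding {M : Type u} {L : Type v} [MetricSpace M] [MetricSpace L] (i : M → L) : Prop :=
  Isometry i ∧ ∃ e : (M ≃ᵢ M) →* (L ≃ᵢ L), Continuous e ∧
    ∀ (φ : M ≃ᵢ M) (x : M), e φ (i x) = i (φ x)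

/-! Enlarge `M` to X = `WithSeeds M` by adding a separable space that contains every finite metric
space of diameter at most 1. It then suffices to make X homogeneous functorially and without raising
the density: a partial embedding of a finite F extends because an isometry of the hull moves a
ready-made copy of F into position.

To make X homogeneous, adjoin for every pair p = (a, b) of n-tuples an isometry T p with inverse T
(b, a). The pairs are not required to be isometric: T p sends each a i to within the defect of b i,
and p ↦ T p is 6-Lipschitz. This robustness lets the operations pass to the completion, where an
isometric pair is only a limit of pairs of terms with small defect.

One extension step prescribes the numbers `ker p x y`, meaning the distance from T p x to y, and
glues formal images T p x to the space (`IsMotionKernel.extMetric`). Kernels come from approximate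
requirements "T p moves x to within c of y", which are consistent exactly when pairwise compatible
(`LinksCompatible.isMotionKernel`). The crux, `Stage.extLink_compatible`, is that the requirements
for the next step are compatible again.

Iterating gives a pseudometric on terms in the operations T, whose completion is the hull. No
choices are made, so isometries of X act by substitution; the action is pointwise continuous because
the operations are. Terms over a dense subset are dense, which controls the weight. -/

/-! ### Spaces of pairs of tuples. -/

/-- The disjoint union of a sequence of spaces, where distances are truncated at `1` and
different summands are at distance `1`. -/
structure BoundedSigma (E : ℕ → Type u) : Type u where
  /-- The index of the summand. -/
  fst : ℕ
  /-- The point of the summand. -/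
  snd : E fst

namespace BoundedSigma

variable {E : ℕ → Type u} [∀ n, PseudoMetricSpace (E n)]

noncomputable instance : Dist (BoundedSigma E) :=
  ⟨fun p q => if h : p.1 = q.1 then min 1 (dist (h ▸ p.2 : E q.1) q.2) else 1⟩

theorem dist_same {n : ℕ} (x y : E n) :
    dist (⟨n, x⟩ : BoundedSigma E) ⟨n, y⟩ = min 1 (dist x y) := by
  simp [dist]

theorem dist_ne {p q : BoundedSigma E} (h : p.1 ≠ q.1) : dist p q = 1 := by
  simp [dist, h]

theorem dist_le_one (p q : BoundedSigma E) : dist p q ≤ 1 := by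
  by_cases h : p.1 = q.1
  · obtain ⟨n, x⟩ := p
    obtain ⟨m, y⟩ := q
    obtain rfl : n = m := h
    rw [dist_same]
    exact min_le_left _ _
  · exact (dist_ne h).le

noncomputable instance : PseudoMetricSpace (BoundedSigma E) where
  dist_self := by
    rintro ⟨n, x⟩
    simp [dist_same]
  dist_comm := by
    intro p q
    by_cases h : p.1 = q.1
    · obtain ⟨n, x⟩ := p
      obtain ⟨m, y⟩ := q
      obtain rfl : n = m := h
      rw [dist_same, dist_same, dist_comm]
    · rw [dist_ne h, dist_ne (Ne.symm h)]
  dist_triangle := by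
    have nn : ∀ p q : BoundedSigma E, 0 ≤ dist p q := by
      intro p q
      by_cases h : p.1 = q.1
      · obtain ⟨n, x⟩ := p
        obtain ⟨m, y⟩ := q
        obtain rfl : n = m := h
        rw [dist_same]
        positivity
      · rw [dist_ne h]
        norm_num
    intro p q r
    by_cases h : p.1 = q.1
    · by_cases h' : q.1 = r.1
      · obtain ⟨n, x⟩ := p
        obtain ⟨m, y⟩ := q
        obtain ⟨k, z⟩ := r
        obtain rfl : n = m := h
        obtain rfl : n = k := h'
        simp only [dist_same]
        have := dist_triangle x y z
        have h1 : (0 : ℝ) ≤ dist x y := dist_nonneg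
        have h2 : (0 : ℝ) ≤ dist y z := dist_nonneg
        rcases min_cases (1 : ℝ) (dist x y) with h3 | h3 <;>
        rcases min_cases (1 : ℝ) (dist y z) with h4 | h4 <;>
        rcases min_cases (1 : ℝ) (dist x z) with h5 | h5 <;> linarith
      · linarith [dist_ne h', dist_le_one p r, nn p q]
    · linarith [dist_ne h, dist_le_one p r, nn q r]

theorem dist_same_le {n : ℕ} (x y : E n) :
    dist (⟨n, x⟩ : BoundedSigma E) ⟨n, y⟩ ≤ dist x y := by
  rw [dist_same]
  exact min_le_right _ _

end BoundedSigma

/-- Pairs of finite tuples of the same length. -/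
abbrev TuplePair (X : Type u) : Type u :=
  BoundedSigma fun n => (Fin n → X) × (Fin n → X)

namespace TuplePair

variable {X : Type u} {Y : Type v}

/-- The pair of tuples `(a, b)`. -/
def mk {n : ℕ} (a b : Fin n → X) : TuplePair X := ⟨n, a, b⟩

/-- Exchange the two tuples of a pair. -/
def swap (p : TuplePair X) : TuplePair X := mk p.2.2 p.2.1

/-- Apply a map to all entries of a pair of tuples. -/
def map (f : X → Y) (p : TuplePair X) : TuplePair Y := mk (f ∘ p.2.1) (f ∘ p.2.2)

variable [PseudoMetricSpace X] [PseudoMetricSpace Y]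

theorem dist_mk {n : ℕ} (a b a' b' : Fin n → X) :
    dist (mk a b) (mk a' b') = min 1 (max (dist a a') (dist b b')) := by
  rw [mk, mk, BoundedSigma.dist_same]
  rfl

theorem dist_swap (p q : TuplePair X) : dist p.swap q.swap = dist p q := by
  by_cases h : p.1 = q.1
  · obtain ⟨n, a, b⟩ := p
    obtain ⟨m, a', b'⟩ := q
    obtain rfl : n = m := h
    change dist (mk b a) (mk b' a') = dist (mk a b) (mk a' b')
    rw [dist_mk, dist_mk, max_comm]
  · rw [BoundedSigma.dist_ne h]
    exact BoundedSigma.dist_ne h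

theorem dist_map {f : X → Y} (hf : ∀ x y, dist (f x) (f y) = dist x y) (p q : TuplePair X) :
    dist (p.map f) (q.map f) = dist p q := by
  by_cases h : p.1 = q.1
  · obtain ⟨n, a, b⟩ := p
    obtain ⟨m, a', b'⟩ := q
    obtain rfl : n = m := h
    have key : ∀ a a' : Fin n → X, dist (f ∘ a) (f ∘ a') = dist a a' := fun a a' => by
      simp only [dist_pi_def, nndist_dist, Function.comp, hf]
    change dist (mk (f ∘ a) (f ∘ b)) (mk (f ∘ a') (f ∘ b')) = dist (mk a b) (mk a' b')
    rw [dist_mk, dist_mk, key, key]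
  · rw [BoundedSigma.dist_ne h]
    exact BoundedSigma.dist_ne h

/-- `δ` bounds the extent to which `a i ↦ b i` fails to be isometric. -/
def Defect (p : TuplePair X) (δ : ℝ) : Prop :=
  ∀ i j, |dist (p.2.1 i) (p.2.1 j) - dist (p.2.2 i) (p.2.2 j)| ≤ δ

theorem Defect.swap {p : TuplePair X} {δ : ℝ} (h : p.Defect δ) : p.swap.Defect δ :=
  fun i j => by
    have := h i j
    rwa [abs_sub_comm] at this

theorem Defect.map {f : X → Y} (hf : ∀ x y, dist (f x) (f y) = dist x y) {p : TuplePair X}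
    {δ : ℝ} (h : p.Defect δ) : (p.map f).Defect δ := fun i j => by
  change |dist (f _) (f _) - dist (f _) (f _)| ≤ δ
  rw [hf, hf]
  exact h i j

end TuplePair

/-! ### Gluing formal images to a space along a kernel. -/

/-- A kernel `r p x y`, to be thought of as the distance from `T p x` to `y`, where `T p` is an
isometry depending on `p`. -/
structure IsMotionKernel {P : Type u} {X : Type v} [PseudoMetricSpace P] [PseudoMetricSpace X]
    (r : P → X → X → ℝ) : Prop where
  le_one : ∀ p x y, r p x y ≤ 1
  -- The constant 6 is dictated by `base_fwd_compatible`: 4 for the change of the defect and 1 for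
  -- each of two moved endpoints.
  lip : ∀ p q x x' y y',
    r p x y ≤ r q x' y' + (6 * dist p q + dist x x' + dist y y')
  dist_source : ∀ p x x' y, dist x x' ≤ r p x y + r p x' y
  dist_target : ∀ p x y y', dist y y' ≤ r p x y + r p x y'

namespace IsMotionKernel

variable {P : Type u} {X : Type v} [PseudoMetricSpace P] [PseudoMetricSpace X]
  {r : P → X → X → ℝ}

theorem nonneg (h : IsMotionKernel r) (p : P) (x y : X) : 0 ≤ r p x y := by
  have := h.dist_source p x x y
  rw [dist_self] at this
  linarith

theorem dist_le (h : IsMotionKernel r) (p q : P) (x x' y : X) :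
    dist x x' ≤ r p x y + r q x' y + 6 * dist p q := by
  have h1 := h.dist_source p x x' y
  have h2 := h.lip p q x' x' y y
  rw [dist_self, dist_self] at h2
  linarith

/-- The distance between `T p x` and `T q x'` in the extension by formal images. -/
noncomputable def imageDist (r : P → X → X → ℝ) (u v : P × X) : ℝ :=
  min 1 (min (6 * dist u.1 v.1 + dist u.2 v.2) (⨅ y, r u.1 u.2 y + r v.1 v.2 y))

/-- The distance on the extension of `X` by formal images `T p x`. -/
noncomputable def extDist (r : P → X → X → ℝ) : (P × X) ⊕ X → (P × X) ⊕ X → ℝ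
  | .inl u, .inl v => imageDist r u v
  | .inl u, .inr y => r u.1 u.2 y
  | .inr y, .inl u => r u.1 u.2 y
  | .inr x, .inr y => dist x y

theorem bddBelow_sum (h : IsMotionKernel r) (u v : P × X) :
    BddBelow (Set.range fun y => r u.1 u.2 y + r v.1 v.2 y) :=
  ⟨0, by rintro _ ⟨y, rfl⟩; exact add_nonneg (h.nonneg _ _ _) (h.nonneg _ _ _)⟩

theorem imageDist_le_one (r : P → X → X → ℝ) (u v : P × X) : imageDist r u v ≤ 1 :=
  min_le_left _ _

theorem imageDist_le (r : P → X → X → ℝ) (u v : P × X) :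
    imageDist r u v ≤ 6 * dist u.1 v.1 + dist u.2 v.2 :=
  (min_le_right _ _).trans (min_le_left _ _)

theorem imageDist_le_add (h : IsMotionKernel r) (u v : P × X) (y : X) :
    imageDist r u v ≤ r u.1 u.2 y + r v.1 v.2 y :=
  ((min_le_right _ _).trans (min_le_right _ _)).trans (ciInf_le (h.bddBelow_sum u v) y)

theorem le_imageDist (r : P → X → X → ℝ) (u v : P × X) {c : ℝ} (h1 : c ≤ 1)
    (h2 : c ≤ 6 * dist u.1 v.1 + dist u.2 v.2) (h3 : ∀ y, c ≤ r u.1 u.2 y + r v.1 v.2 y) :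
    c ≤ imageDist r u v :=
  have : Nonempty X := ⟨u.2⟩
  le_min h1 (le_min h2 (le_ciInf h3))

theorem imageDist_comm (r : P → X → X → ℝ) (u v : P × X) :
    imageDist r u v = imageDist r v u := by
  simp only [imageDist, dist_comm u.1, dist_comm u.2, add_comm (r u.1 u.2 _)]

theorem imageDist_nonneg (h : IsMotionKernel r) (u v : P × X) : 0 ≤ imageDist r u v :=
  le_imageDist r u v zero_le_one (by positivity)
    fun _ => add_nonneg (h.nonneg _ _ _) (h.nonneg _ _ _)

theorem kernel_le_imageDist (h : IsMotionKernel r) (u v : P × X) (y : X) :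
    r u.1 u.2 y ≤ imageDist r u v + r v.1 v.2 y := by
  rw [← sub_le_iff_le_add]
  refine le_imageDist r u v ?_ ?_ fun z => ?_
  · linarith [h.le_one u.1 u.2 y, h.nonneg v.1 v.2 y]
  · have := h.lip u.1 v.1 u.2 v.2 y y
    rw [dist_self] at this
    linarith
  · have h1 := h.lip u.1 u.1 u.2 u.2 y z
    have h2 := h.dist_target v.1 v.2 y z
    rw [dist_self, dist_self] at h1
    linarith

/-- A detour from T p x to T q x' through a point y of X is no shortcut, by `dist_source` and the
Lipschitz condition. For equal parameters, this and `imageDist_le` say that each T p is an isometry.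
-/
theorem dist_le_imageDist (h : IsMotionKernel r) (hX : ∀ x y : X, dist x y ≤ 1) (u v : P × X) :
    dist u.2 v.2 ≤ imageDist r u v + 6 * dist u.1 v.1 := by
  rw [← sub_le_iff_le_add]
  have h0 : 0 ≤ dist u.1 v.1 := dist_nonneg
  refine le_imageDist r u v ?_ ?_ fun z => ?_
  · linarith [hX u.2 v.2]
  · linarith
  · linarith [h.dist_le u.1 v.1 u.2 v.2 z]

/-- Each leg is truncated, direct, or passes through a point of X. A leg through y absorbs the other
leg by `kernel_le_imageDist`; two direct legs add up to a direct one. -/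
theorem imageDist_triangle (h : IsMotionKernel r) (u v w : P × X) :
    imageDist r u w ≤ imageDist r u v + imageDist r v w := by
  rw [← sub_le_iff_le_add]
  refine le_imageDist r u v ?_ ?_ fun y => ?_
  · linarith [imageDist_le_one r u w, h.imageDist_nonneg v w]
  · rw [sub_le_iff_le_add, ← sub_le_iff_le_add']
    refine le_imageDist r v w ?_ ?_ fun y => ?_
    · have := imageDist_le_one r u w
      have : 0 ≤ 6 * dist u.1 v.1 + dist u.2 v.2 := by positivity
      linarith
    · have := imageDist_le r u w
      linarith [dist_triangle u.1 v.1 w.1, dist_triangle u.2 v.2 w.2]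
    · have := h.imageDist_le_add u w y
      have := h.lip u.1 v.1 u.2 v.2 y y
      rw [dist_self] at this
      linarith
  · have h1 := h.kernel_le_imageDist w v y
    rw [imageDist_comm] at h1
    linarith [h.imageDist_le_add u w y]

/-- The extension of `X` by formal images `T p x`. -/
@[reducible] noncomputable def extMetric (h : IsMotionKernel r) :
    PseudoMetricSpace ((P × X) ⊕ X) where
  dist := extDist r
  dist_self := by
    rintro (u | x)
    · refine le_antisymm ?_ (h.imageDist_nonneg u u)
      have := imageDist_le r u u
      rwa [dist_self, dist_self, mul_zero, add_zero] at this
    · exact dist_self x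
  dist_comm := by
    rintro (u | x) (v | y)
    · exact imageDist_comm r u v
    · rfl
    · rfl
    · exact dist_comm x y
  dist_triangle := by
    rintro (u | x) (v | y) (w | z)
    · exact h.imageDist_triangle u v w
    · exact h.kernel_le_imageDist u v z
    · exact h.imageDist_le_add u w y
    · have h1 := h.lip u.1 u.1 u.2 u.2 z y
      rw [dist_self, dist_self, dist_comm] at h1
      change r u.1 u.2 z ≤ r u.1 u.2 y + dist y z
      linarith
    · have h1 := h.kernel_le_imageDist w v x
      rw [imageDist_comm] at h1
      change r w.1 w.2 x ≤ r v.1 v.2 x + imageDist r v w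
      linarith
    · exact h.dist_target v.1 v.2 x z
    · have h1 := h.lip w.1 w.1 w.2 w.2 x y
      rw [dist_self, dist_self] at h1
      change r w.1 w.2 x ≤ dist x y + r w.1 w.2 y
      linarith
    · exact dist_triangle x y z

end IsMotionKernel

/-! ### Kernels generated by approximate requirements. -/

section LinkKernel

variable {P : Type u} {X : Type v} [PseudoMetricSpace P] [PseudoMetricSpace X]

/-- The largest kernel for which `T p` moves `x` to within `c` of `y` whenever `R p x y c`. -/
noncomputable def linkKernel (R : P → X → X → ℝ → Prop) (p : P) (x y : X) : ℝ :=
  sInf (insert 1 {v | ∃ q x' y' c, R q x' y' c ∧ v = c + (6 * dist p q + dist x x' + dist y y')})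

/-- The links in `R` can be realized by isometries. -/
def LinksCompatible (R : P → X → X → ℝ → Prop) : Prop :=
  ∀ p x y c q x' y' c', R p x y c → R q x' y' c' →
    |dist x x' - dist y y'| ≤ 6 * dist p q + c + c'

variable {R : P → X → X → ℝ → Prop}

theorem LinksCompatible.nonneg (h : LinksCompatible R) {p x y c} (hc : R p x y c) : 0 ≤ c := by
  have := h p x y c p x y c hc hc
  simp only [dist_self, sub_self, abs_zero] at this
  linarith

theorem LinksCompatible.bddBelow (h : LinksCompatible R) (p : P) (x y : X) :
    BddBelow (insert 1 {v | ∃ q x' y' c, R q x' y' c ∧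
      v = c + (6 * dist p q + dist x x' + dist y y')}) := by
  refine ⟨0, ?_⟩
  rintro v (rfl | ⟨q, x', y', c, hc, rfl⟩)
  · exact zero_le_one
  · have := h.nonneg hc
    positivity

theorem LinksCompatible.linkKernel_le_one (h : LinksCompatible R) (p : P) (x y : X) :
    linkKernel R p x y ≤ 1 :=
  csInf_le (h.bddBelow p x y) (Set.mem_insert _ _)

theorem LinksCompatible.linkKernel_le' (h : LinksCompatible R) (p : P) (x y : X) {q x' y' c}
    (hc : R q x' y' c) :
    linkKernel R p x y ≤ c + (6 * dist p q + dist x x' + dist y y') :=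
  csInf_le (h.bddBelow p x y) (Or.inr ⟨q, x', y', c, hc, rfl⟩)

theorem LinksCompatible.linkKernel_le (h : LinksCompatible R) {p x y c}
    (hc : R p x y c) : linkKernel R p x y ≤ c := by
  simpa using h.linkKernel_le' p x y hc

theorem le_linkKernel {p : P} {x y : X} {v : ℝ} (h1 : v ≤ 1)
    (h : ∀ q x' y' c, R q x' y' c → v ≤ c + (6 * dist p q + dist x x' + dist y y')) :
    v ≤ linkKernel R p x y := by
  refine le_csInf ⟨1, Set.mem_insert _ _⟩ ?_
  rintro _ (rfl | ⟨q, x', y', c, hc, rfl⟩)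
  · exact h1
  · exact h q x' y' c hc

/-- As an infimum of Lipschitz functions, the kernel has the upper estimates for free. The two lower
estimates compare a pair of links and use one side each of the absolute value in compatibility; the
truncation at 1 is harmless because distances are at most 1. -/
theorem LinksCompatible.isMotionKernel (h : LinksCompatible R) (hX : ∀ x y : X, dist x y ≤ 1) :
    IsMotionKernel (linkKernel R) := by
  have nonneg : ∀ p x y, 0 ≤ linkKernel R p x y := fun p x y =>
    le_linkKernel zero_le_one fun q x' y' c hc => by
      have := h.nonneg hc
      positivity
  refine ⟨h.linkKernel_le_one, ?_, ?_, ?_⟩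
  · intro p q x x' y y'
    rw [← sub_le_iff_le_add]
    refine le_linkKernel ?_ fun s z w c hc => ?_
    · have := h.linkKernel_le_one p x y
      have : 0 ≤ 6 * dist p q + dist x x' + dist y y' := by positivity
      linarith
    · linarith [h.linkKernel_le' p x y hc, dist_triangle p q s, dist_triangle x x' z,
        dist_triangle y y' w]
  · intro p x x' y
    rw [← sub_le_iff_le_add]
    refine le_linkKernel (by linarith [hX x x', nonneg p x' y]) fun s z w c hc => ?_
    rw [sub_le_iff_le_add, ← sub_le_iff_le_add']
    refine le_linkKernel ?_ fun s' z' w' c' hc' => ?_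
    · have : 0 ≤ 6 * dist p s + dist x z + dist y w := by positivity
      linarith [hX x x', h.nonneg hc]
    · have := le_of_abs_le (h _ _ _ _ _ _ _ _ hc hc')
      linarith [dist_triangle_left s s' p, dist_triangle_left w w' y, dist_triangle4 x z z' x',
        dist_comm z' x']
  · intro p x y y'
    rw [← sub_le_iff_le_add]
    refine le_linkKernel (by linarith [hX y y', nonneg p x y']) fun s z w c hc => ?_
    rw [sub_le_iff_le_add, ← sub_le_iff_le_add']
    refine le_linkKernel ?_ fun s' z' w' c' hc' => ?_
    · have : 0 ≤ 6 * dist p s + dist x z + dist y w := by positivity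
      linarith [hX y y', h.nonneg hc]
    · have := neg_le_of_abs_le (h _ _ _ _ _ _ _ _ hc hc')
      linarith [dist_triangle_left s s' p, dist_triangle_left z z' x, dist_triangle4 y w w' y',
        dist_comm w' y']

theorem LinksCompatible.linkKernel_map_le (h : LinksCompatible R) {f : P → P} {g k : X → X}
    (hf : ∀ p q, dist (f p) (f q) = dist p q) (hg : ∀ x y, dist (g x) (g y) = dist x y)
    (hk : ∀ x y, dist (k x) (k y) = dist x y)
    (hR : ∀ p x y c, R p x y c → R (f p) (g x) (k y) c) (p : P) (x y : X) :
    linkKernel R (f p) (g x) (k y) ≤ linkKernel R p x y := by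
  refine le_linkKernel (h.linkKernel_le_one _ _ _) fun q x' y' c hc => ?_
  have := h.linkKernel_le' (f p) (g x) (k y) (hR _ _ _ _ hc)
  rwa [hf, hg, hk] at this

theorem LinksCompatible.linkKernel_swap_le (h : LinksCompatible R) {f : P → P}
    (hf : ∀ p q, dist (f p) (f q) = dist p q)
    (hR : ∀ p x y c, R p x y c → R (f p) y x c) (p : P) (x y : X) :
    linkKernel R (f p) y x ≤ linkKernel R p x y := by
  refine le_linkKernel (h.linkKernel_le_one _ _ _) fun q x' y' c hc => ?_
  have := h.linkKernel_le' (f p) y x (hR _ _ _ _ hc)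
  rw [hf] at this
  linarith

end LinkKernel

/-! ### Stages and the one-step extension. -/

/-- A space of diameter at most `1` with a kernel describing the isometries to be adjoined. -/
structure Stage : Type (u + 1) where
  /-- The points. -/
  carrier : Type u
  /-- The metric. -/
  [metric : PseudoMetricSpace carrier]
  /-- The kernel. -/
  ker : TuplePair carrier → carrier → carrier → ℝ
  dist_le_one : ∀ x y : carrier, dist x y ≤ 1
  isMotionKernel : IsMotionKernel ker
  ker_swap : ∀ p x y, ker p.swap y x = ker p x y
  ker_base : ∀ p δ, p.Defect δ → ∀ i, ker p (p.2.1 i) (p.2.2 i) ≤ δ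

attribute [instance] Stage.metric

/-- The links prescribing that `T (a, b)` moves `a i` to within the defect of `b i`. -/
inductive BaseLink {X : Type u} [PseudoMetricSpace X] : TuplePair X → X → X → ℝ → Prop
  | base (p : TuplePair X) (i : Fin p.1) (δ : ℝ) (h : p.Defect δ) :
      BaseLink p (p.2.1 i) (p.2.2 i) δ

namespace TuplePair

variable {X : Type u} [PseudoMetricSpace X]

theorem dist_entry_le {n : ℕ} (a b a' b' : Fin n → X) (h : dist (mk a b) (mk a' b') < 1) (i) :
    dist (a i) (a' i) ≤ dist (mk a b) (mk a' b') ∧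
      dist (b i) (b' i) ≤ dist (mk a b) (mk a' b') := by
  rw [dist_mk] at h ⊢
  have h1 : max (dist a a') (dist b b') < 1 := by
    by_contra! hc
    rw [min_eq_left hc] at h
    exact lt_irrefl _ h
  rw [min_eq_right h1.le]
  exact ⟨(dist_le_pi_dist a a' i).trans (le_max_left _ _),
    (dist_le_pi_dist b b' i).trans (le_max_right _ _)⟩

theorem dist_lt_one_imp {p q : TuplePair X} (h : dist p q < 1) : p.1 = q.1 := by
  by_contra hne
  rw [BoundedSigma.dist_ne hne] at h
  exact lt_irrefl _ h

theorem Defect.nonneg {p : TuplePair X} {δ : ℝ} (h : p.Defect δ) (i : Fin p.1) : 0 ≤ δ :=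
  (abs_nonneg _).trans (h i i)

/-- The defects of close pairs of tuples are close. -/
theorem Defect.of_dist {n : ℕ} {a b a' b' : Fin n → X} {δ : ℝ} (h : (mk a b).Defect δ)
    (hd : dist (mk a b) (mk a' b') < 1) :
    (mk a' b').Defect (δ + 4 * dist (mk a b) (mk a' b')) := fun i j => by
  have hij : |dist (a i) (a j) - dist (b i) (b j)| ≤ δ := h i j
  have hi := dist_entry_le a b a' b' hd i
  have hj := dist_entry_le a b a' b' hd j
  change |dist (a' i) (a' j) - dist (b' i) (b' j)| ≤ _
  rw [abs_le] at hij ⊢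
  -- Each of the four distances to the new tuples differs from the old entries by at most the
  -- distance of the pairs, hence the factor 4.
  constructor <;>
  linarith [dist_triangle4 (a' i) (a i) (a j) (a' j), dist_triangle4 (b i) (b' i) (b' j) (b j),
    dist_triangle4 (b' i) (b i) (b j) (b' j), dist_triangle4 (a i) (a' i) (a' j) (a j),
    dist_comm (a i) (a' i), dist_comm (a j) (a' j), dist_comm (b i) (b' i),
    dist_comm (b j) (b' j)]

end TuplePair

theorem BaseLink.swap {X : Type u} [PseudoMetricSpace X] {p : TuplePair X} {x y : X} {c : ℝ}
    (h : BaseLink p x y c) : BaseLink p.swap y x c := by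
  obtain ⟨i, c, h⟩ := h
  exact BaseLink.base p.swap i c h.swap

theorem BaseLink.map {X : Type u} [PseudoMetricSpace X] {f : X → X}
    (hf : ∀ x y, dist (f x) (f y) = dist x y) {p : TuplePair X} {x y : X} {c : ℝ}
    (h : BaseLink p x y c) : BaseLink (p.map f) (f x) (f y) c := by
  obtain ⟨i, c, h⟩ := h
  exact BaseLink.base (p.map f) i c (h.map hf)

/-- For pairs at distance d < 1, replacing the entries with index j costs d on each side, so c + 2d
suffices. Otherwise 6d ≥ 1 already bounds any difference of distances, even when the lengths differ.
-/
theorem baseLink_compatible {X : Type u} [PseudoMetricSpace X] (hX : ∀ x y : X, dist x y ≤ 1) :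
    LinksCompatible (BaseLink (X := X)) := by
  have aux : ∀ u v x y : X, |dist u v - dist x y| ≤ 1 := fun u v x y => by
    rw [abs_le]
    constructor <;> linarith [hX u v, hX x y, @dist_nonneg _ _ u v, @dist_nonneg _ _ x y]
  rintro p _ _ c q _ _ c' ⟨i, _, h⟩ ⟨j, _, h'⟩
  have hc := h.nonneg i
  have hc' := h'.nonneg j
  by_cases hd : dist p q < 1
  · have e := TuplePair.dist_lt_one_imp hd
    obtain ⟨n, a, b⟩ := p
    obtain ⟨m, a', b'⟩ := q
    obtain rfl : n = m := e
    have hj := TuplePair.dist_entry_le a b a' b' hd j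
    have hij : |dist (a i) (a j) - dist (b i) (b j)| ≤ c := h i j
    change |dist (a i) (a' j) - dist (b i) (b' j)| ≤
      6 * dist (TuplePair.mk a b) (TuplePair.mk a' b') + c + c'
    rw [abs_le] at hij ⊢
    have : 0 ≤ dist (TuplePair.mk a b) (TuplePair.mk a' b') := dist_nonneg
    constructor <;>
    linarith [dist_triangle (a i) (a j) (a' j), dist_triangle_right (a i) (a j) (a' j),
      dist_triangle (b i) (b j) (b' j), dist_triangle_right (b i) (b j) (b' j)]
  · exact (aux _ _ _ _).trans (by linarith)

namespace Stage

/-- The initial stage over a space of diameter at most `1`. -/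
noncomputable def init (X : Type u) [PseudoMetricSpace X] (hX : ∀ x y : X, dist x y ≤ 1) :
    Stage.{u} where
  carrier := X
  ker := linkKernel BaseLink
  dist_le_one := hX
  isMotionKernel := (baseLink_compatible hX).isMotionKernel hX
  ker_swap := fun p x y =>
    le_antisymm
      ((baseLink_compatible hX).linkKernel_swap_le TuplePair.dist_swap
        (fun _ _ _ _ h => h.swap) p x y)
      ((baseLink_compatible hX).linkKernel_swap_le TuplePair.dist_swap
        (fun _ _ _ _ h => h.swap) p.swap y x)
  ker_base := fun p δ h i => (baseLink_compatible hX).linkKernel_le (BaseLink.base p i δ h)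

variable (S : Stage.{u})

/-- The points of the next stage: formal images `T p x`, and the old points. -/
def Ext : Type u := (TuplePair S.carrier × S.carrier) ⊕ S.carrier

/-- The formal image `T p x`. -/
def img (p : TuplePair S.carrier) (x : S.carrier) : S.Ext := Sum.inl (p, x)

/-- The inclusion of a stage into the next one. -/
def incl (x : S.carrier) : S.Ext := Sum.inr x

noncomputable instance : PseudoMetricSpace S.Ext := S.isMotionKernel.extMetric

theorem dist_incl (x y : S.carrier) : dist (S.incl x) (S.incl y) = dist x y := rfl

theorem dist_img_incl (p : TuplePair S.carrier) (x y : S.carrier) :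
    dist (S.img p x) (S.incl y) = S.ker p x y := rfl

theorem dist_img_le (p q : TuplePair S.carrier) (x y : S.carrier) :
    dist (S.img p x) (S.img q y) ≤ 6 * dist p q + dist x y :=
  IsMotionKernel.imageDist_le S.ker (p, x) (q, y)

theorem le_dist_img (p q : TuplePair S.carrier) (x y : S.carrier) :
    dist x y ≤ dist (S.img p x) (S.img q y) + 6 * dist p q :=
  S.isMotionKernel.dist_le_imageDist S.dist_le_one (p, x) (q, y)

theorem ext_dist_le_one : ∀ x y : S.Ext, dist x y ≤ 1
  | .inl u, .inl v => IsMotionKernel.imageDist_le_one S.ker u v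
  | .inl u, .inr y => S.isMotionKernel.le_one u.1 u.2 y
  | .inr y, .inl u => S.isMotionKernel.le_one u.1 u.2 y
  | .inr x, .inr y => S.dist_le_one x y

/-- The links of the next stage. -/
inductive ExtLink : TuplePair S.Ext → S.Ext → S.Ext → ℝ → Prop
  -- Cost 0 makes the next operation agree with the formal images already present, and makes the
  -- swapped pair undo it.
  | fwd (p : TuplePair S.carrier) (x : S.carrier) :
      ExtLink (p.map S.incl) (S.incl x) (S.img p x) 0
  | bwd (p : TuplePair S.carrier) (x : S.carrier) :
      ExtLink (p.map S.incl).swap (S.img p x) (S.incl x) 0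
  | base {p x y c} (h : BaseLink p x y c) : ExtLink p x y c

variable {S}

theorem ExtLink.swap {p x y c} (h : S.ExtLink p x y c) : S.ExtLink p.swap y x c := by
  rcases h with ⟨p, x⟩ | ⟨p, x⟩ | h
  · exact .bwd p x
  · exact .fwd p x
  · exact .base h.swap

theorem fwd_fwd_compatible (p q : TuplePair S.carrier) (x y : S.carrier) :
    |dist (S.incl x) (S.incl y) - dist (S.img p x) (S.img q y)| ≤
      6 * dist (p.map S.incl) (q.map S.incl) := by
  rw [TuplePair.dist_map S.dist_incl, dist_incl, abs_le]
  constructor <;> linarith [S.dist_img_le p q x y, S.le_dist_img p q x y]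

/-- By `ker_swap` both distances are values of the kernel at the same two points, with parameters p
and `q.swap`; the Lipschitz condition compares them. -/
theorem fwd_bwd_compatible (p q : TuplePair S.carrier) (x y : S.carrier) :
    |dist (S.incl x) (S.img q y) - dist (S.img p x) (S.incl y)| ≤
      6 * dist (p.map S.incl) (q.map S.incl).swap := by
  have h : dist (p.map S.incl) (q.map S.incl).swap = dist p q.swap :=
    TuplePair.dist_map S.dist_incl p q.swap
  rw [h, dist_comm (S.incl x), dist_img_incl, dist_img_incl, ← S.ker_swap q, abs_le]
  have h1 := S.isMotionKernel.lip p q.swap x x y y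
  have h2 := S.isMotionKernel.lip q.swap p x x y y
  rw [dist_self, dist_self] at h1 h2
  rw [dist_comm] at h2
  constructor <;> linarith

/-- With d the distance of the pairs, the defect of q is at most c + 4d, so `ker_base` puts the
image of its i-th source entry within c + 4d of its i-th target entry. Passing from these to the
entries of s costs d on each side, for a total of c + 6d. -/
theorem base_fwd_compatible {s : TuplePair S.Ext} {z w : S.Ext} {c : ℝ} (h : BaseLink s z w c)
    (q : TuplePair S.carrier) (x : S.carrier) :
    |dist z (S.incl x) - dist w (S.img q x)| ≤ 6 * dist s (q.map S.incl) + c := by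
  obtain ⟨i, _, h⟩ := h
  have hc := h.nonneg i
  by_cases hd : dist s (q.map S.incl) < 1
  · have e := TuplePair.dist_lt_one_imp hd
    obtain ⟨n, a, b⟩ := s
    obtain ⟨m, a', b'⟩ := q
    obtain rfl : n = m := e
    have hi := TuplePair.dist_entry_le a b (S.incl ∘ a') (S.incl ∘ b') hd i
    have hq := TuplePair.Defect.of_dist h hd
    have hq' : (TuplePair.mk a' b').Defect
        (c + 4 * dist (TuplePair.mk a b) (TuplePair.mk (S.incl ∘ a') (S.incl ∘ b'))) := hq
    have h1 := S.ker_base _ _ hq' i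
    change S.ker (TuplePair.mk a' b') (a' i) (b' i) ≤ _ at h1
    rw [← dist_img_incl] at h1
    have h2 := S.dist_img_le (TuplePair.mk a' b') (TuplePair.mk a' b') (a' i) x
    have h3 := S.le_dist_img (TuplePair.mk a' b') (TuplePair.mk a' b') (a' i) x
    rw [dist_self] at h2 h3
    change |dist (a i) (S.incl x) - dist (b i) (S.img (TuplePair.mk a' b') x)| ≤
      6 * dist (TuplePair.mk a b) (TuplePair.mk (S.incl ∘ a') (S.incl ∘ b')) + c
    rw [← dist_incl] at h2 h3
    simp only [Function.comp] at hi
    generalize S.img (TuplePair.mk a' b') x = v at *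
    generalize S.img (TuplePair.mk a' b') (a' i) = v' at *
    rw [abs_le]
    constructor
    · linarith [dist_triangle4 (b i) (S.incl (b' i)) v' v, dist_comm (S.incl (b' i)) v',
        dist_triangle_left (S.incl (a' i)) (S.incl x) (a i)]
    · linarith [dist_triangle4 v' (S.incl (b' i)) (b i) v, dist_comm (S.incl (b' i)) (b i),
        dist_triangle (a i) (S.incl (a' i)) (S.incl x)]
  -- Here the pairs are at distance at least 1, while distances lie in [0, 1].
  · refine (?_ : _ ≤ (1 : ℝ)).trans (by linarith)
    rw [abs_le]
    constructor <;> linarith [S.ext_dist_le_one (s.2.1 i) (S.incl x),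
      S.ext_dist_le_one (s.2.2 i) (S.img q x), @dist_nonneg _ _ (s.2.1 i) (S.incl x),
      @dist_nonneg _ _ (s.2.2 i) (S.img q x)]

theorem base_bwd_compatible {s : TuplePair S.Ext} {z w : S.Ext} {c : ℝ} (h : BaseLink s z w c)
    (q : TuplePair S.carrier) (x : S.carrier) :
    |dist z (S.img q x) - dist w (S.incl x)| ≤ 6 * dist s (q.map S.incl).swap + c := by
  have := base_fwd_compatible h.swap q x
  rwa [abs_sub_comm, ← TuplePair.dist_swap] at this

variable (S) in
theorem extLink_compatible : LinksCompatible S.ExtLink := by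
  intro p x y c q x' y' c' h h'
  rcases h with ⟨p, x⟩ | ⟨p, x⟩ | h <;> rcases h' with ⟨q, x'⟩ | ⟨q, x'⟩ | h'
  · simpa using fwd_fwd_compatible p q x x'
  · simpa using fwd_bwd_compatible p q x x'
  · have := base_fwd_compatible h' p x
    rwa [dist_comm x', dist_comm y', dist_comm q, ← add_zero (6 * _)] at this
  · have := fwd_bwd_compatible q p x' x
    rw [abs_sub_comm]
    rw [dist_comm (S.incl x'), dist_comm (S.img q x'), dist_comm (q.map _)] at this
    rw [abs_sub_comm]
    simpa using this
  · have := fwd_fwd_compatible p q x x'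
    rw [abs_sub_comm, ← TuplePair.dist_swap] at this
    simpa using this
  · have := base_bwd_compatible h' p x
    rwa [dist_comm x', dist_comm y', dist_comm q, ← add_zero (6 * _)] at this
  · simpa using base_fwd_compatible h q x'
  · simpa using base_bwd_compatible h q x'
  · exact baseLink_compatible S.ext_dist_le_one _ _ _ _ _ _ _ _ h h'

variable (S)

/-- The next stage, in which the images `T p x` of the points of `S` are realized. -/
noncomputable def step : Stage.{u} where
  carrier := S.Ext
  ker := linkKernel S.ExtLink
  dist_le_one := S.ext_dist_le_one
  isMotionKernel := S.extLink_compatible.isMotionKernel S.ext_dist_le_one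
  ker_swap := fun p x y =>
    le_antisymm
      (S.extLink_compatible.linkKernel_swap_le TuplePair.dist_swap
        (fun _ _ _ _ h => h.swap) p x y)
      (S.extLink_compatible.linkKernel_swap_le TuplePair.dist_swap
        (fun _ _ _ _ h => h.swap) p.swap y x)
  ker_base := fun p δ h i =>
    S.extLink_compatible.linkKernel_le (.base (BaseLink.base p i δ h))

/-- Links of cost 0 become coincidences in the pseudometric, so an image formed again one stage
later is the old image up to distance 0. -/
theorem dist_img_incl_step (p : TuplePair S.carrier) (x : S.carrier) :
    dist (S.step.img (p.map S.incl) (S.incl x)) (S.step.incl (S.img p x)) = 0 :=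
  le_antisymm (S.extLink_compatible.linkKernel_le (.fwd p x)) dist_nonneg

theorem dist_img_swap_step (p : TuplePair S.carrier) (x : S.carrier) :
    dist (S.step.img (p.map S.incl).swap (S.img p x)) (S.step.incl (S.incl x)) = 0 :=
  le_antisymm (S.extLink_compatible.linkKernel_le (.bwd p x)) dist_nonneg

/-! ### Functoriality of the extension. -/

/-- An automorphism of a stage. -/
structure Aut where
  /-- The underlying permutation. -/
  perm : Equiv.Perm S.carrier
  dist_perm : ∀ x y, dist (perm x) (perm y) = dist x y
  ker_perm : ∀ p x y, S.ker (p.map perm) (perm x) (perm y) = S.ker p x y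

variable {S}

theorem _root_.TuplePair.map_map {X Y Z : Type*} (f : X → Y) (g : Y → Z) (p : TuplePair X) :
    (p.map f).map g = p.map (g ∘ f) := rfl

theorem _root_.TuplePair.map_id {X : Type*} (p : TuplePair X) : p.map id = p := rfl

/-- The inverse automorphism. -/
def Aut.symm (σ : S.Aut) : S.Aut where
  perm := σ.perm.symm
  dist_perm := fun x y => by
    rw [← σ.dist_perm, Equiv.apply_symm_apply, Equiv.apply_symm_apply]
  ker_perm := fun p x y => by
    rw [← σ.ker_perm, Equiv.apply_symm_apply, Equiv.apply_symm_apply, TuplePair.map_map,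
      Equiv.self_comp_symm, TuplePair.map_id]

/-- The automorphism of the initial stage given by an isometry. -/
noncomputable def Aut.init {X : Type u} [PseudoMetricSpace X] (hX : ∀ x y : X, dist x y ≤ 1)
    (e : X ≃ᵢ X) : (Stage.init X hX).Aut where
  perm := e.toEquiv
  dist_perm := e.dist_eq
  ker_perm := fun (p : TuplePair X) (x y : X) => by
    refine le_antisymm ((baseLink_compatible hX).linkKernel_map_le
      (TuplePair.dist_map e.dist_eq) e.dist_eq e.dist_eq (fun _ _ _ _ h => h.map e.dist_eq) p x y)
      ?_
    have := (baseLink_compatible hX).linkKernel_map_le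
      (TuplePair.dist_map e.symm.dist_eq) e.symm.dist_eq e.symm.dist_eq
      (fun _ _ _ _ h => h.map e.symm.dist_eq) (p.map e) (e x) (e y)
    rwa [e.symm_apply_apply, e.symm_apply_apply, TuplePair.map_map, e.symm_comp_self,
      TuplePair.map_id] at this

/-- The action of an automorphism on pairs of tuples. -/
def Aut.tuplePerm (σ : S.Aut) : Equiv.Perm (TuplePair S.carrier) where
  toFun := TuplePair.map σ.perm
  invFun := TuplePair.map σ.perm.symm
  left_inv := fun p => by
    rw [TuplePair.map_map, Equiv.symm_comp_self, TuplePair.map_id]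
  right_inv := fun p => by
    rw [TuplePair.map_map, Equiv.self_comp_symm, TuplePair.map_id]

/-- The action of an automorphism on the points of the next stage. -/
def Aut.extPerm (σ : S.Aut) : Equiv.Perm S.Ext :=
  Equiv.sumCongr (Equiv.prodCongr σ.tuplePerm σ.perm) σ.perm

theorem Aut.dist_extPerm (σ : S.Aut) : ∀ x y, dist (σ.extPerm x) (σ.extPerm y) = dist x y := by
  rintro (⟨p, x⟩ | x) (⟨q, y⟩ | y)
  · change IsMotionKernel.imageDist S.ker (p.map σ.perm, σ.perm x) (q.map σ.perm, σ.perm y) =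
      IsMotionKernel.imageDist S.ker (p, x) (q, y)
    simp only [IsMotionKernel.imageDist, TuplePair.dist_map σ.dist_perm, σ.dist_perm]
    congr 2
    rw [← σ.perm.iInf_comp]
    simp only [σ.ker_perm]
  · exact σ.ker_perm p x y
  · exact σ.ker_perm q y x
  · exact σ.dist_perm x y

theorem Aut.extLink_map (σ : S.Aut) {p x y c} (h : S.ExtLink p x y c) :
    S.ExtLink (p.map σ.extPerm) (σ.extPerm x) (σ.extPerm y) c := by
  rcases h with ⟨p, x⟩ | ⟨p, x⟩ | h
  · exact .fwd (p.map σ.perm) (σ.perm x)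
  · exact .bwd (p.map σ.perm) (σ.perm x)
  · exact .base (h.map σ.dist_extPerm)

/-- The automorphism of the next stage induced by an automorphism. -/
noncomputable def Aut.step (σ : S.Aut) : S.step.Aut where
  perm := σ.extPerm
  dist_perm := σ.dist_extPerm
  ker_perm := fun (p : TuplePair S.Ext) (x y : S.Ext) => by
    refine le_antisymm (S.extLink_compatible.linkKernel_map_le
      (TuplePair.dist_map σ.dist_extPerm) σ.dist_extPerm σ.dist_extPerm
      (fun _ _ _ _ h => σ.extLink_map h) p x y) ?_
    have := S.extLink_compatible.linkKernel_map_le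
      (TuplePair.dist_map σ.symm.dist_extPerm) σ.symm.dist_extPerm σ.symm.dist_extPerm
      (fun _ _ _ _ h => σ.symm.extLink_map h) (p.map σ.extPerm) (σ.extPerm x) (σ.extPerm y)
    have e : ∀ z, σ.symm.extPerm (σ.extPerm z) = z := σ.extPerm.symm_apply_apply
    rwa [e, e, TuplePair.map_map, show σ.symm.extPerm ∘ σ.extPerm = id from funext e,
      TuplePair.map_id] at this

end Stage

/-! ### Terms and their limit pseudometric. -/

/-- Terms over `X` in operations `T (a, b)`, where `a` and `b` are tuples of the same length. -/
inductive MotionTerm (X : Type u) : Type u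
  | base (x : X) : MotionTerm X
  | app {n : ℕ} (a b : Fin n → MotionTerm X) (t : MotionTerm X) : MotionTerm X

/-- Distances are at most `1`. -/
class IsUnitBounded (X : Type u) [PseudoMetricSpace X] : Prop where
  dist_le_one : ∀ x y : X, dist x y ≤ 1

namespace Stage

variable (X : Type u) [PseudoMetricSpace X] [IsUnitBounded X]

/-- The tower of stages over `X`. -/
noncomputable def tower : ℕ → Stage.{u}
  | 0 => init X IsUnitBounded.dist_le_one
  | N + 1 => (tower N).step

variable {X}

/-- The inclusion of `X` into the tower. -/
noncomputable def baseIncl (x : X) : ∀ N, (tower X N).carrier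
  | 0 => x
  | N + 1 => (tower X N).incl (baseIncl x N)

theorem dist_baseIncl (x y : X) : ∀ N, dist (baseIncl x N) (baseIncl y N) = dist x y
  | 0 => rfl
  | N + 1 => dist_baseIncl x y N

/-- The automorphisms of the tower induced by an isometry. -/
noncomputable def towerAut (e : X ≃ᵢ X) : ∀ N, (tower X N).Aut
  | 0 => Aut.init IsUnitBounded.dist_le_one e
  | N + 1 => (towerAut e N).step

theorem towerAut_baseIncl (e : X ≃ᵢ X) (x : X) :
    ∀ N, (towerAut e N).perm (baseIncl x N) = baseIncl (e x) N
  | 0 => rfl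
  | N + 1 => congrArg (tower X N).incl (towerAut_baseIncl e x N)

end Stage

namespace MotionTerm

open Stage Filter

section Map

variable {X Y Z : Type*}

/-- Substitution of points in terms. -/
def map (f : X → Y) : MotionTerm X → MotionTerm Y
  | base x => base (f x)
  | app a b t => app (fun i => map f (a i)) (fun i => map f (b i)) (map f t)

theorem map_id (t : MotionTerm X) : t.map id = t := by
  induction t with
  | base x => rfl
  | app a b t iha ihb iht => simp only [map, iha, ihb, iht]

theorem map_map (f : X → Y) (g : Y → Z) (t : MotionTerm X) :
    (t.map f).map g = t.map (g ∘ f) := by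
  induction t with
  | base x => rfl
  | app a b t iha ihb iht => simp only [map, iha, ihb, iht]

end Map

variable {X : Type u} [PseudoMetricSpace X] [IsUnitBounded X]

/-- The value of a term in the stages of the tower. -/
noncomputable def eval : MotionTerm X → ∀ N, (tower X N).carrier
  | base x, N => baseIncl x N
  -- A default value, since stage 0 has no formal images. Only large stages affect distances, but
  -- the default must commute with isometries for `eval_map`.
  | app _ _ t, 0 => eval t 0
  | app a b t, N + 1 =>
    (tower X N).img (TuplePair.mk (fun i => eval (a i) N) fun i => eval (b i) N) (eval t N)

/-- By induction, the arguments at consecutive stages eventually agree up to distance 0. The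
Lipschitz bound for images replaces the new arguments by the old ones, and `dist_img_incl_step`
identifies the resulting image with the old one. -/
theorem eventually_dist_eval_succ (t : MotionTerm X) :
    ∀ᶠ N in atTop, dist (eval t (N + 1)) ((tower X N).incl (eval t N)) = 0 := by
  induction t with
  | base x => exact Eventually.of_forall fun N => dist_self _
  | @app n a b t iha ihb iht =>
    have h : ∀ᶠ N in atTop,
        dist (eval (app a b t) (N + 1 + 1))
          ((tower X (N + 1)).incl (eval (app a b t) (N + 1))) = 0 := by
      filter_upwards [eventually_all.2 iha, eventually_all.2 ihb, iht] with N ha hb ht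
      let p : TuplePair (tower X N).carrier :=
        TuplePair.mk (fun i => eval (a i) N) fun i => eval (b i) N
      let p' : TuplePair (tower X N).Ext :=
        TuplePair.mk (fun i => eval (a i) (N + 1)) fun i => eval (b i) (N + 1)
      have hp : dist p' (p.map (tower X N).incl) = 0 := by
        refine le_antisymm ?_ dist_nonneg
        refine (BoundedSigma.dist_same_le _ _).trans (max_le ?_ ?_)
        · exact (dist_pi_le_iff le_rfl).2 fun i => (ha i).le
        · exact (dist_pi_le_iff le_rfl).2 fun i => (hb i).le
      refine le_antisymm ?_ dist_nonneg
      have h1 := (tower X N).step.dist_img_le p' (p.map (tower X N).incl) (eval t (N + 1))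
        ((tower X N).incl (eval t N))
      have h2 := (tower X N).dist_img_incl_step p (eval t N)
      have h3 := dist_triangle ((tower X N).step.img p' (eval t (N + 1)))
        ((tower X N).step.img (p.map (tower X N).incl) ((tower X N).incl (eval t N)))
        ((tower X N).step.incl ((tower X N).img p (eval t N)))
      change dist ((tower X N).step.img p' (eval t (N + 1)))
        ((tower X N).step.incl ((tower X N).img p (eval t N))) ≤ 0
      change dist (eval t (N + 1)) ((tower X N).incl (eval t N)) = 0 at ht
      have ht' : @dist (tower X N).step.carrier _ (eval t (N + 1))
        ((tower X N).incl (eval t N)) = 0 := ht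
      have hp' : @dist (TuplePair (tower X N).step.carrier) _ p'
        (p.map (tower X N).incl) = 0 := hp
      linarith
    -- The shift is needed because the value of an application at stage N + 1 is built from its
    -- arguments at stage N.
    rw [← map_add_atTop_eq_nat 1, eventually_map]
    exact h

theorem dist_congr_of_zero {Y : Type*} [PseudoMetricSpace Y] {x x' y y' : Y}
    (hx : dist x x' = 0) (hy : dist y y' = 0) : dist x y = dist x' y' := by
  have h1 := dist_triangle4 x x' y' y
  have h2 := dist_triangle4 x' x y y'
  rw [dist_comm x' x] at h2
  rw [dist_comm y' y] at h1
  linarith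

/-- The inclusions are isometric, so distances are constant once both values have stabilized. This
replaces a direct limit of the stages. -/
theorem exists_dist (s t : MotionTerm X) :
    ∃ c, ∀ᶠ N in atTop, dist (eval s N) (eval t N) = c := by
  obtain ⟨N, hN⟩ := eventually_atTop.1
    ((eventually_dist_eval_succ s).and (eventually_dist_eval_succ t))
  refine ⟨dist (eval s N) (eval t N), eventually_atTop.2 ⟨N, fun K hK => ?_⟩⟩
  induction K, hK using Nat.le_induction with
  | base => rfl
  | succ K hK ih =>
    rw [← ih, ← dist_incl]
    exact dist_congr_of_zero (hN K hK).1 (hN K hK).2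

noncomputable instance : Dist (MotionTerm X) := ⟨fun s t => (exists_dist s t).choose⟩

theorem eventually_dist (s t : MotionTerm X) :
    ∀ᶠ N in atTop, dist (eval s N) (eval t N) = dist s t :=
  (exists_dist s t).choose_spec

noncomputable instance : PseudoMetricSpace (MotionTerm X) where
  dist_self := fun t => by
    obtain ⟨N, h⟩ := (eventually_dist t t).exists
    rw [← h, dist_self]
  dist_comm := fun s t => by
    obtain ⟨N, h, h'⟩ := ((eventually_dist s t).and (eventually_dist t s)).exists
    rw [← h, ← h', dist_comm]
  dist_triangle := fun r s t => by
    obtain ⟨N, h, h', h''⟩ :=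
      ((eventually_dist r t).and ((eventually_dist r s).and (eventually_dist s t))).exists
    rw [← h, ← h', ← h'']
    exact dist_triangle _ _ _

instance : IsUnitBounded (MotionTerm X) where
  dist_le_one := fun s t => by
    obtain ⟨N, h⟩ := (eventually_dist s t).exists
    rw [← h]
    exact (tower X N).dist_le_one _ _

theorem dist_base (x y : X) : dist (base x) (base y) = dist x y := by
  obtain ⟨N, h⟩ := (eventually_dist (base x) (base y)).exists
  rw [← h]
  exact dist_baseIncl x y N

theorem eventually_dist_succ (s t : MotionTerm X) :
    ∀ᶠ N in atTop, dist (eval s (N + 1)) (eval t (N + 1)) = dist s t :=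
  (tendsto_add_atTop_nat 1).eventually (eventually_dist s t)

theorem eventually_dist_tuple {n : ℕ} (a b : Fin n → MotionTerm X) :
    ∀ᶠ N in atTop, dist (fun i => eval (a i) N) (fun i => eval (b i) N) = dist a b := by
  filter_upwards [eventually_all.2 fun i => eventually_dist (a i) (b i)] with N h
  simp only [dist_pi_def, nndist_dist, h]

theorem dist_app_le {n : ℕ} (a b a' b' : Fin n → MotionTerm X) (s t : MotionTerm X) :
    dist (app a b s) (app a' b' t) ≤ 6 * max (dist a a') (dist b b') + dist s t := by
  obtain ⟨N, h, ha, hb, hs⟩ := ((eventually_dist_succ (app a b s) (app a' b' t)).and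
    ((eventually_dist_tuple a a').and
      ((eventually_dist_tuple b b').and (eventually_dist s t)))).exists
  rw [← h, ← ha, ← hb, ← hs]
  refine ((tower X N).dist_img_le _ _ _ _).trans ?_
  have := BoundedSigma.dist_same_le (E := fun n => (Fin n → (tower X N).carrier) ×
    (Fin n → (tower X N).carrier)) ((fun i => eval (a i) N), fun i => eval (b i) N)
    ((fun i => eval (a' i) N), fun i => eval (b' i) N)
  rw [Prod.dist_eq] at this
  have h2 := mul_le_mul_of_nonneg_left this (by norm_num : (0 : ℝ) ≤ 6)
  exact add_le_add_left h2 _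

theorem dist_app_swap {n : ℕ} (a b : Fin n → MotionTerm X) (t : MotionTerm X) :
    dist (app b a (app a b t)) t = 0 := by
  -- The term t is taken at stage N, its image lives at N + 1, and the backward link returns it to t
  -- at N + 2.
  have key : ∀ᶠ N in atTop, dist (eval (app b a (app a b t)) (N + 2))
      ((tower X (N + 1)).incl ((tower X N).incl (eval t N))) = 0 := by
    filter_upwards [eventually_all.2 fun i => eventually_dist_eval_succ (a i),
      eventually_all.2 fun i => eventually_dist_eval_succ (b i)] with N ha hb
    let p : TuplePair (tower X N).carrier :=
      TuplePair.mk (fun i => eval (a i) N) fun i => eval (b i) N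
    let p' : TuplePair (tower X N).step.carrier :=
      TuplePair.mk (fun i => eval (b i) (N + 1)) fun i => eval (a i) (N + 1)
    have hp : @dist (TuplePair (tower X N).step.carrier) _ p'
        (p.map (tower X N).incl).swap = 0 := by
      refine le_antisymm ?_ dist_nonneg
      refine (BoundedSigma.dist_same_le _ _).trans (max_le ?_ ?_)
      · exact (dist_pi_le_iff le_rfl).2 fun i => (hb i).le
      · exact (dist_pi_le_iff le_rfl).2 fun i => (ha i).le
    have h1 := (tower X N).step.dist_img_le p' (p.map (tower X N).incl).swap
      ((tower X N).img p (eval t N)) ((tower X N).img p (eval t N))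
    have h2 := (tower X N).dist_img_swap_step p (eval t N)
    refine le_antisymm ?_ dist_nonneg
    refine (dist_triangle _ _ _).trans ((add_le_add h1 h2.le).trans ?_)
    have h0 : @dist (tower X N).step.carrier _ ((tower X N).img p (eval t N))
      ((tower X N).img p (eval t N)) = 0 := dist_self _
    rw [hp, h0]
    norm_num
  obtain ⟨N, h, h0, h1, h2⟩ := (((tendsto_add_atTop_nat 2).eventually
    (eventually_dist (app b a (app a b t)) t)).and (key.and
      ((eventually_dist_eval_succ t).and ((tendsto_add_atTop_nat 1).eventually
        (eventually_dist_eval_succ t))))).exists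
  rw [← h]
  refine le_antisymm ?_ dist_nonneg
  change dist (eval t (N + 2)) ((tower X (N + 1)).incl (eval t (N + 1))) = 0 at h2
  have h3 : dist ((tower X (N + 1)).incl (eval t (N + 1)))
      ((tower X (N + 1)).incl ((tower X N).incl (eval t N))) = 0 := h1
  refine (dist_triangle_right _ _ _).trans ((add_le_add h0.le
    ((dist_triangle _ _ _).trans (add_le_add h2.le h3.le))).trans ?_)
  norm_num

/-- Every operation is nonexpansive and, up to distance 0, has another nonexpansive operation as a
left inverse. -/
theorem dist_app_app {n : ℕ} (a b : Fin n → MotionTerm X) (s t : MotionTerm X) :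
    dist (app a b s) (app a b t) = dist s t := by
  have key : ∀ (a b : Fin n → MotionTerm X) (s t : MotionTerm X),
      dist (app a b s) (app a b t) ≤ dist s t := fun a b s t => by
    simpa using dist_app_le a b a b s t
  refine le_antisymm (key a b s t) ?_
  rw [← dist_congr_of_zero (dist_app_swap a b s) (dist_app_swap a b t)]
  exact key b a _ _

theorem dist_app_entry_le {n : ℕ} (a b : Fin n → MotionTerm X) {δ : ℝ}
    (h : ∀ i j, |dist (a i) (a j) - dist (b i) (b j)| ≤ δ) (i : Fin n) :
    dist (app a b (a i)) (b i) ≤ δ := by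
  obtain ⟨N, h1, h2, h3, h4⟩ := ((eventually_dist_succ (app a b (a i)) (b i)).and
    ((eventually_all.2 fun i => eventually_all.2 fun j => eventually_dist (a i) (a j)).and
      ((eventually_all.2 fun i => eventually_all.2 fun j => eventually_dist (b i) (b j)).and
        (eventually_dist_eval_succ (b i))))).exists
  rw [← h1, dist_congr_of_zero (dist_self _) h4]
  have hd : ∀ i j,
      |dist (eval (a i) N) (eval (a j) N) - dist (eval (b i) N) (eval (b j) N)| ≤ δ := fun i j => by
    rw [h2, h3]
    exact h i j
  exact (tower X N).ker_base (TuplePair.mk (fun i => eval (a i) N) fun i => eval (b i) N) δ hd i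

theorem eval_map (e : X ≃ᵢ X) (t : MotionTerm X) :
    ∀ N, eval (t.map e) N = (towerAut e N).perm (eval t N) := by
  induction t with
  | base x => exact fun N => (towerAut_baseIncl e x N).symm
  | app a b t iha ihb iht =>
    rintro (_ | N)
    · exact iht 0
    · simp only [map, eval, iha, ihb, iht]
      rfl

theorem dist_map (e : X ≃ᵢ X) (s t : MotionTerm X) : dist (s.map e) (t.map e) = dist s t := by
  obtain ⟨N, h, h'⟩ :=
    ((eventually_dist (s.map e) (t.map e)).and (eventually_dist s t)).exists
  rw [← h, ← h', eval_map, eval_map]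
  exact (towerAut e N).dist_perm _ _

end MotionTerm

/-! ### The completed hull and its homogeneity. -/

/-- The completion of the space of terms over `X`. -/
abbrev HomogeneousHull (X : Type u) [PseudoMetricSpace X] [IsUnitBounded X] : Type u :=
  UniformSpace.Completion (MotionTerm X)

namespace HomogeneousHull

open UniformSpace MotionTerm

variable {X : Type u} [PseudoMetricSpace X] [IsUnitBounded X]

theorem dist_le_one (x y : HomogeneousHull X) : dist x y ≤ 1 := by
  refine Completion.induction_on₂ x y (isClosed_le continuous_dist continuous_const) fun s t => ?_
  rw [Completion.dist_eq]
  exact IsUnitBounded.dist_le_one s t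

theorem isometry_coe_tuple (n : ℕ) :
    Isometry fun p : (Fin n → MotionTerm X) × (Fin n → MotionTerm X) × MotionTerm X =>
      ((fun i => (p.1 i : HomogeneousHull X), fun i => (p.2.1 i : HomogeneousHull X), (p.2.2 : _)) :
        (Fin n → HomogeneousHull X) × (Fin n → HomogeneousHull X) × HomogeneousHull X) := by
  refine Isometry.of_dist_eq fun p q => ?_
  simp only [Prod.dist_eq, dist_pi_def, nndist_dist, Completion.dist_eq]

theorem denseRange_coe_tuple (n : ℕ) :
    DenseRange fun p : (Fin n → MotionTerm X) × (Fin n → MotionTerm X) × MotionTerm X =>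
      ((fun i => (p.1 i : HomogeneousHull X), fun i => (p.2.1 i : HomogeneousHull X), (p.2.2 : _)) :
        (Fin n → HomogeneousHull X) × (Fin n → HomogeneousHull X) × HomogeneousHull X) :=
  have h : DenseRange (Pi.map fun (_ : Fin n) => ((↑) : MotionTerm X → HomogeneousHull X)) :=
    DenseRange.piMap fun _ => Completion.denseRange_coe
  h.prodMap (h.prodMap Completion.denseRange_coe)

theorem lipschitzWith_app (n : ℕ) :
    LipschitzWith 7 fun p : (Fin n → MotionTerm X) × (Fin n → MotionTerm X) × MotionTerm X =>
      app p.1 p.2.1 p.2.2 := by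
  refine LipschitzWith.of_dist_le_mul fun p q => (dist_app_le _ _ _ _ _ _).trans ?_
  have h1 : max (dist p.1 q.1) (dist p.2.1 q.2.1) ≤ dist p q :=
    max_le (le_max_left _ _) ((le_max_left _ _).trans (le_max_right _ _))
  have h2 : dist p.2.2 q.2.2 ≤ dist p q := (le_max_right _ _).trans (le_max_right _ _)
  rw [NNReal.coe_ofNat]
  linarith

/-- The operations on terms extend continuously to the completion. -/
theorem exists_app_extension (X : Type u) [PseudoMetricSpace X] [IsUnitBounded X] (n : ℕ) :
    ∃ A : (Fin n → HomogeneousHull X) × (Fin n → HomogeneousHull X) × HomogeneousHull X →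
        HomogeneousHull X,
      Continuous A ∧ ∀ (a b : Fin n → MotionTerm X) (t : MotionTerm X),
        A (fun i => (a i : HomogeneousHull X), fun i => (b i : HomogeneousHull X), (t : _)) =
          (app a b t : MotionTerm X) := by
  have hi := (isometry_coe_tuple (X := X) n).isUniformInducing
  have hd := denseRange_coe_tuple (X := X) n
  have hu := (Completion.uniformContinuous_coe (MotionTerm X)).comp
    (lipschitzWith_app (X := X) n).uniformContinuous
  exact ⟨_, (uniformContinuous_uniformly_extend hi hd hu).continuous,
    fun a b t => uniformly_extend_of_ind hi hd hu (a, b, t)⟩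

/-- Isometries between finite tuples of the hull extend to the hull. -/
theorem exists_isometryEquiv {n : ℕ} (a b : Fin n → HomogeneousHull X)
    (h : ∀ i j, dist (a i) (a j) = dist (b i) (b j)) :
    ∃ g : HomogeneousHull X ≃ᵢ HomogeneousHull X, ∀ i, g (a i) = b i := by
  obtain ⟨A, hA, hcoe⟩ := exists_app_extension X n
  have hdist : ∀ (a b : Fin n → HomogeneousHull X) (x y : HomogeneousHull X),
      dist (A (a, b, x)) (A (a, b, y)) ≤ dist x y := fun a b x y => by
    revert y
    refine (denseRange_coe_tuple (X := X) n).induction_on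
      (p := fun q => ∀ y, dist (A q) (A (q.1, q.2.1, y)) ≤ dist q.2.2 y) (a, b, x) ?_ ?_
    · simp only [Set.ofPred_forall]
      refine isClosed_iInter fun y => isClosed_le ?_ ?_ <;> fun_prop
    · rintro ⟨a, b, x⟩ y
      refine Completion.induction_on y (isClosed_le ?_ ?_) fun t => ?_
      · fun_prop
      · fun_prop
      · simp only [hcoe, Completion.dist_eq]
        exact (dist_app_app a b x t).le
  have hswap : ∀ (a b : Fin n → HomogeneousHull X) (x : HomogeneousHull X),
      A (b, a, A (a, b, x)) = x := fun a b x => by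
    refine (denseRange_coe_tuple (X := X) n).induction_on
      (p := fun q => A (q.2.1, q.1, A q) = q.2.2) (a, b, x) (isClosed_eq ?_ ?_) ?_
    · fun_prop
    · fun_prop
    · rintro ⟨a, b, x⟩
      rw [← dist_eq_zero]
      simp only [hcoe, Completion.dist_eq]
      exact dist_app_swap a b x
  -- The tuples are limits of tuples of terms that need not be isometric. Summing the defects gives
  -- a bound continuous in the tuples, so it passes to the limit, and it vanishes on isometric
  -- tuples.
  have hentry : ∀ (a b : Fin n → HomogeneousHull X) (i : Fin n),
      dist (A (a, b, a i)) (b i) ≤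
        ∑ j, ∑ k, |dist (a j) (a k) - dist (b j) (b k)| := fun a b i => by
    refine (denseRange_coe_tuple (X := X) n).induction_on
      (p := fun q => dist (A (q.1, q.2.1, q.1 i)) (q.2.1 i) ≤
        ∑ j, ∑ k, |dist (q.1 j) (q.1 k) - dist (q.2.1 j) (q.2.1 k)|) (a, b, a i)
        (isClosed_le ?_ ?_) ?_
    · fun_prop
    · fun_prop
    · rintro ⟨a, b, x⟩
      simp only [hcoe, Completion.dist_eq]
      refine dist_app_entry_le a b (fun j k => ?_) i
      refine (Finset.single_le_sum (f := fun k => |dist (a j) (a k) - dist (b j) (b k)|)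
        (fun _ _ => abs_nonneg _) (Finset.mem_univ k)).trans ?_
      exact Finset.single_le_sum
        (f := fun j => ∑ k, |dist (a j) (a k) - dist (b j) (b k)|)
        (fun _ _ => Finset.sum_nonneg fun _ _ => abs_nonneg _) (Finset.mem_univ j)
  have hiso : Isometry fun x => A (a, b, x) := Isometry.of_dist_eq fun x y => by
    refine le_antisymm (hdist a b x y) ?_
    have := hdist b a (A (a, b, x)) (A (a, b, y))
    rwa [hswap, hswap] at this
  refine ⟨IsometryEquiv.mk' (fun x => A (a, b, x)) (fun x => A (b, a, x)) (hswap b a) hiso,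
    fun i => ?_⟩
  have := hentry a b i
  simp only [h, sub_self, abs_zero, Finset.sum_const_zero] at this
  exact dist_le_zero.1 this

theorem isOmegaHomogeneous : IsOmegaHomogeneous (HomogeneousHull X) := by
  intro A B hA _ f
  have : Finite A := hA
  obtain ⟨n, ⟨e⟩⟩ := Finite.exists_equiv_fin A
  obtain ⟨g, hg⟩ := exists_isometryEquiv (fun i => ((e.symm i : A) : HomogeneousHull X))
    (fun i => (f (e.symm i) : HomogeneousHull X)) fun i j => (f.dist_eq _ _).symm
  refine ⟨g, fun a => ?_⟩
  have := hg (e a)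
  rwa [e.symm_apply_apply] at this

/-! ### The action of isometries of the base on the hull. -/

/-- The inclusion of `X` into the hull. -/
noncomputable def incl (x : X) : HomogeneousHull X := ((base x : MotionTerm X) : HomogeneousHull X)

theorem dist_incl (x y : X) : dist (incl x) (incl y) = dist x y := by
  rw [incl, incl, Completion.dist_eq, dist_base]

theorem isometry_map (e : X ≃ᵢ X) : Isometry (MotionTerm.map e : MotionTerm X → MotionTerm X) :=
  Isometry.of_dist_eq (MotionTerm.dist_map e)

theorem completion_map_map (e e' : X ≃ᵢ X) (x : HomogeneousHull X) :
    Completion.map (MotionTerm.map e) (Completion.map (MotionTerm.map e') x) =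
      Completion.map (MotionTerm.map (e * e' : X ≃ᵢ X)) x := by
  refine Completion.induction_on x (isClosed_eq ?_ ?_) fun t => ?_
  · exact Completion.continuous_map.comp Completion.continuous_map
  · exact Completion.continuous_map
  · rw [Completion.map_coe (isometry_map e').uniformContinuous,
      Completion.map_coe (isometry_map e).uniformContinuous,
      Completion.map_coe (isometry_map _).uniformContinuous, MotionTerm.map_map]
    rfl

theorem completion_map_one (x : HomogeneousHull X) :
    Completion.map (MotionTerm.map (1 : X ≃ᵢ X)) x = x := by
  have : (MotionTerm.map (1 : X ≃ᵢ X) : MotionTerm X → MotionTerm X) = id :=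
    funext MotionTerm.map_id
  rw [this, Completion.map_id, id]

/-- Isometries of `X` act on the hull. -/
noncomputable def extend : (X ≃ᵢ X) →* (HomogeneousHull X ≃ᵢ HomogeneousHull X) where
  toFun e := IsometryEquiv.mk' (Completion.map (MotionTerm.map e))
    (Completion.map (MotionTerm.map (e⁻¹ : X ≃ᵢ X)))
    (fun x => by rw [completion_map_map, mul_inv_cancel, completion_map_one])
    (isometry_map e).completion_map
  map_one' := by
    ext x
    exact completion_map_one x
  map_mul' e e' := by
    ext x
    exact (completion_map_map e e' x).symm

theorem extend_coe (e : X ≃ᵢ X) (t : MotionTerm X) :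
    extend e (t : HomogeneousHull X) = (t.map e : MotionTerm X) :=
  Completion.map_coe (isometry_map e).uniformContinuous t

theorem extend_incl (e : X ≃ᵢ X) (x : X) : extend e (incl x) = incl (e x) :=
  extend_coe e (base x)

theorem continuous_app {n : ℕ} :
    Continuous fun p : (Fin n → MotionTerm X) × (Fin n → MotionTerm X) × MotionTerm X =>
      app p.1 p.2.1 p.2.2 :=
  (lipschitzWith_app n).continuous

theorem continuous_map_term {G : Type*} [TopologicalSpace G] {φ : G → (X ≃ᵢ X)}
    (hφ : ∀ x, Continuous fun g => φ g x) (t : MotionTerm X) :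
    Continuous fun g => t.map (φ g) := by
  induction t with
  | base x => exact (Isometry.of_dist_eq dist_base).continuous.comp (hφ x)
  | app a b t iha ihb iht =>
    exact continuous_app.comp
      ((continuous_pi iha).prodMk ((continuous_pi ihb).prodMk iht))

/-- For a term in place of y, continuity follows by induction from that of the operations. Since all
the extensions are isometries, approximating y by a term costs the same error for every g. -/
theorem continuous_extend_apply {G : Type*} [TopologicalSpace G] {φ : G → (X ≃ᵢ X)}
    (hφ : ∀ x, Continuous fun g => φ g x) (y : HomogeneousHull X) :
    Continuous fun g => extend (φ g) y := by
  refine continuous_iff_continuousAt.2 fun g => Metric.tendsto_nhds.2 fun ε hε => ?_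
  obtain ⟨t, ht⟩ := Metric.denseRange_iff.1 (Completion.denseRange_coe (α := MotionTerm X)) y
    (ε / 3) (by positivity)
  have hc : Continuous fun g => extend (φ g) (t : HomogeneousHull X) := by
    simp only [extend_coe]
    exact (Completion.continuous_coe _).comp (continuous_map_term hφ t)
  filter_upwards [Metric.tendsto_nhds.1 (hc.tendsto g) (ε / 3) (by positivity)] with k hk
  have h1 := dist_triangle4 (extend (φ k) y) (extend (φ k) t) (extend (φ g) t) (extend (φ g) y)
  rw [IsometryEquiv.dist_eq, IsometryEquiv.dist_eq, dist_comm (t : HomogeneousHull X)] at h1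
  linarith

end HomogeneousHull

/-! ### Weight and density. -/

section Weight

open TopologicalSpace

theorem exists_basis_mk_eq_topWeight (X : Type u) [TopologicalSpace X] :
    ∃ B : Set (Set X), IsTopologicalBasis B ∧ #B = topWeight X :=
  csInf_mem (s := {c | ∃ B : Set (Set X), IsTopologicalBasis B ∧ #B = c})
    ⟨_, _, isTopologicalBasis_opens, rfl⟩

theorem topWeight_le {X : Type u} [TopologicalSpace X] {B : Set (Set X)}
    (hB : IsTopologicalBasis B) : topWeight X ≤ #B :=
  csInf_le' ⟨B, hB, rfl⟩

theorem topWeight_le_of_isInducing {X Y : Type u} [TopologicalSpace X] [TopologicalSpace Y]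
    {f : X → Y} (hf : IsInducing f) : topWeight X ≤ topWeight Y := by
  obtain ⟨B, hB, hcard⟩ := exists_basis_mk_eq_topWeight Y
  rw [← hcard]
  exact (topWeight_le (hB.isInducing hf)).trans mk_image_le

/-- In a T0 space a point is determined by the basic sets containing it, so a finite base would
leave only finitely many points. -/
theorem aleph0_le_topWeight (X : Type u) [TopologicalSpace X] [T0Space X] [Infinite X] :
    ℵ₀ ≤ topWeight X := by
  obtain ⟨B, hB, hcard⟩ := exists_basis_mk_eq_topWeight X
  rw [← hcard]
  by_contra! hlt
  have : Finite B := lt_aleph0_iff_finite.1 hlt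
  refine not_finite_iff_infinite.2 ‹Infinite X›
    (Finite.of_injective (fun x : X => {U : B | x ∈ (U : Set X)}) fun x y hxy => ?_)
  refine hB.inseparable_iff.2 (fun U hU => ?_) |>.eq
  exact Set.ext_iff.1 hxy ⟨U, hU⟩

theorem exists_dense_mk_le_topWeight (X : Type u) [TopologicalSpace X] :
    ∃ D : Set X, Dense D ∧ #D ≤ topWeight X := by
  obtain ⟨B, hB, hcard⟩ := exists_basis_mk_eq_topWeight X
  rw [← hcard]
  let C : Type u := {U : B // (U : Set X).Nonempty}
  refine ⟨Set.range fun U : C => U.2.choose, hB.dense_iff.2 fun U hU hne => ?_, ?_⟩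
  · exact ⟨_, Exists.choose_spec hne, ⟨⟨⟨U, hU⟩, hne⟩, rfl⟩⟩
  · exact mk_range_le.trans (mk_subtype_le _)

theorem topWeight_le_of_dense {X : Type u} [PseudoMetricSpace X] {D : Set X} (hD : Dense D) :
    topWeight X ≤ max #D ℵ₀ := by
  have hB : IsTopologicalBasis
      (Set.range fun p : D × ℕ => Metric.ball (p.1 : X) (1 / ((p.2 : ℝ) + 1))) := by
    refine isTopologicalBasis_of_isOpen_of_nhds ?_ fun x U hx hU => ?_
    · rintro _ ⟨p, rfl⟩
      exact Metric.isOpen_ball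
    · obtain ⟨ε, hε, hball⟩ := Metric.isOpen_iff.1 hU x hx
      obtain ⟨n, hn⟩ := exists_nat_one_div_lt (half_pos hε)
      obtain ⟨d, hd, hxd⟩ := Metric.dense_iff.1 hD x (1 / ((n : ℝ) + 1)) (by positivity)
      refine ⟨_, ⟨(⟨d, hxd⟩, n), rfl⟩, Metric.mem_ball'.2 hd, fun y hy => hball ?_⟩
      rw [Metric.mem_ball] at hd hy ⊢
      linarith [dist_triangle y d x]
  refine (topWeight_le hB).trans (mk_range_le.trans ?_)
  rw [mk_prod, lift_uzero, mk_nat, lift_aleph0]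
  exact (mul_le_max _ _).trans (max_le le_rfl (le_max_right _ _))

end Weight

/-! ### Counting terms and the weight of the hull. -/

namespace MotionTerm

/-- The arities of the operations. -/
def Arity (D : Type u) : D ⊕ ℕ → Type
  | .inl _ => Empty
  | .inr n => Fin n ⊕ Fin n ⊕ Unit

instance (D : Type u) : ∀ s, Finite (Arity D s)
  | .inl _ => inferInstanceAs (Finite Empty)
  | .inr n => inferInstanceAs (Finite (Fin n ⊕ Fin n ⊕ Unit))

/-- Terms as well-founded trees. -/
def toTree {D : Type u} : MotionTerm D → WType (Arity D)
  | base x => ⟨.inl x, Empty.elim⟩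
  | app (n := n) a b t =>
    ⟨.inr n, Sum.elim (fun i => toTree (a i)) (Sum.elim (fun i => toTree (b i)) fun _ => toTree t)⟩

theorem toTree_injective (D : Type u) : Function.Injective (toTree (D := D)) := by
  intro s
  induction s with
  | base x =>
    rintro (y | ⟨a, b, t⟩) h
    · injection h with h
      injection h with h
      rw [h]
    · injection h with h
      cases h
  | @app n a b t iha ihb iht =>
    rintro (y | @⟨m, a', b', t'⟩) h
    · injection h with h
      cases h
    · injection h with h1 h2
      injection h1 with h1
      subst h1
      have h := congrFun (eq_of_heq h2)
      obtain rfl : a = a' := funext fun i => iha i (h (Sum.inl i))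
      obtain rfl : b = b' := funext fun i => ihb i (h (Sum.inr (Sum.inl i)))
      obtain rfl : t = t' := iht (h (Sum.inr (Sum.inr ())))
      rfl

theorem mk_le (D : Type u) : #(MotionTerm D) ≤ max #D ℵ₀ := by
  refine (mk_le_of_injective (toTree_injective D)).trans
    (WType.cardinalMk_le_max_aleph0_of_finite'.trans (max_le ?_ (le_max_right _ _)))
  rw [lift_uzero, mk_sum, lift_uzero, mk_nat, lift_aleph0]
  exact (add_le_max _ _).trans (max_le le_rfl (le_max_right _ _))

/-- The closure of the terms over D contains the points of X and, because the operations are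
continuous, is stable under them. -/
theorem denseRange_map_val {X : Type u} [PseudoMetricSpace X] [IsUnitBounded X] {D : Set X}
    (hD : Dense D) :
    DenseRange (MotionTerm.map (Subtype.val : D → X)) := by
  intro t
  induction t with
  | base x =>
    refine map_mem_closure (Isometry.of_dist_eq dist_base).continuous (hD x) fun d hd => ?_
    exact ⟨base ⟨d, hd⟩, rfl⟩
  | @app n a b t iha ihb iht =>
    have hc := HomogeneousHull.continuous_app (X := X) (n := n)
    have hmem : (a, b, t) ∈ closure
        ((Set.univ.pi fun _ : Fin n => Set.range (MotionTerm.map (Subtype.val : D → X))) ×ˢ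
        ((Set.univ.pi fun _ : Fin n => Set.range (MotionTerm.map (Subtype.val : D → X))) ×ˢ
          Set.range (MotionTerm.map (Subtype.val : D → X)))) := by
      rw [closure_prod_eq, closure_prod_eq, closure_pi_set]
      exact ⟨fun i _ => iha i, fun i _ => ihb i, iht⟩
    refine map_mem_closure (f := fun p : (Fin n → MotionTerm X) × (Fin n → MotionTerm X) ×
      MotionTerm X => app p.1 p.2.1 p.2.2) hc hmem ?_
    rintro ⟨a, b, _⟩ ⟨ha, hb, ⟨t, rfl⟩⟩
    choose a' ha' using fun i => ha i trivial
    choose b' hb' using fun i => hb i trivial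
    exact ⟨app a' b' t, by simp only [map, ha', hb']⟩

end MotionTerm

theorem HomogeneousHull.topWeight_le {X : Type u} [PseudoMetricSpace X] [IsUnitBounded X]
    {D : Set X} (hD : Dense D) : topWeight (HomogeneousHull X) ≤ max #D ℵ₀ := by
  have h := (UniformSpace.Completion.denseRange_coe (α := MotionTerm X)).comp
    (MotionTerm.denseRange_map_val hD) (UniformSpace.Completion.continuous_coe _)
  refine (topWeight_le_of_dense h).trans (max_le (mk_range_le.trans ?_) (le_max_right _ _))
  exact MotionTerm.mk_le D

/-! ### A separable reservoir of finite metric spaces. -/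

/-- A separable space containing all finite metric spaces of diameter at most `1`. -/
abbrev Seeds : Type := BoundedSigma fun n => Fin n → unitInterval

theorem Seeds.exists_countable_dense : ∃ D : Set Seeds, D.Countable ∧ Dense D := by
  have h : TopologicalSpace.IsSeparable (⋃ n, Set.range fun x : Fin n → unitInterval =>
      (⟨n, x⟩ : Seeds)) := by
    refine TopologicalSpace.IsSeparable.iUnion fun n =>
      TopologicalSpace.isSeparable_range (LipschitzWith.continuous (K := 1) ?_)
    refine LipschitzWith.of_dist_le_mul fun x y => ?_
    rw [NNReal.coe_one, one_mul]
    exact BoundedSigma.dist_same_le (E := fun n => Fin n → unitInterval) x y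
  obtain ⟨D, hD, hsub⟩ := h
  refine ⟨D, hD, fun p => hsub ?_⟩
  exact Set.mem_iUnion.2 ⟨p.1, p.2, rfl⟩

/-- This is the Fréchet embedding: the coordinates of x are its distances to all points of F, and
the coordinate at y shows that the sup distance is not too small. -/
theorem Seeds.exists_isometry (F : Type u) [MetricSpace F] [Finite F]
    (hF : ∀ x y : F, dist x y ≤ 1) : ∃ j : F → Seeds, Isometry j := by
  obtain ⟨n, ⟨e⟩⟩ := Finite.exists_equiv_fin F
  let v : F → Fin n → unitInterval := fun x i => ⟨dist x (e.symm i), dist_nonneg, hF _ _⟩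
  have hv : ∀ x y, dist (v x) (v y) = dist x y := fun x y => by
    refine le_antisymm ((dist_pi_le_iff dist_nonneg).2 fun i => abs_dist_sub_le x y _) ?_
    have h := dist_le_pi_dist (v x) (v y) (e y)
    change |dist x (e.symm (e y)) - dist y (e.symm (e y))| ≤ _ at h
    rw [e.symm_apply_apply, dist_self, sub_zero] at h
    exact (le_abs_self _).trans h
  refine ⟨fun x => ⟨n, v x⟩, Isometry.of_dist_eq fun x y => ?_⟩
  rw [BoundedSigma.dist_same, hv, min_eq_right (hF x y)]

/-- The disjoint union of `M` and `Seeds`, at distance `1` from each other. -/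
def WithSeeds (M : Type u) : Type u := M ⊕ Seeds

namespace WithSeeds

variable {M : Type u}

/-- The points of `M`. -/
def inl (x : M) : WithSeeds M := Sum.inl x

/-- The points of `Seeds`. -/
def inr (s : Seeds) : WithSeeds M := Sum.inr s

variable [PseudoMetricSpace M] [IsUnitBounded M]

noncomputable instance : PseudoMetricSpace (WithSeeds M) where
  dist
    | .inl x, .inl y => dist x y
    | .inr x, .inr y => dist x y
    | .inl _, .inr _ => 1
    | .inr _, .inl _ => 1
  dist_self := by
    rintro (x | x)
    · exact dist_self x
    · exact dist_self x
  dist_comm := by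
    rintro (x | x) (y | y)
    · exact dist_comm x y
    · rfl
    · rfl
    · exact dist_comm x y
  dist_triangle := by
    have h1 : ∀ x y : M, dist x y ≤ 1 + 1 := fun x y =>
      (IsUnitBounded.dist_le_one x y).trans (by norm_num)
    have h2 : ∀ x y : Seeds, dist x y ≤ 1 + 1 := fun x y =>
      (BoundedSigma.dist_le_one x y).trans (by norm_num)
    rintro (x | x) (y | y) (z | z)
    · exact dist_triangle x y z
    · exact le_add_of_nonneg_left dist_nonneg
    · exact h1 x z
    · exact le_add_of_nonneg_right dist_nonneg
    · exact le_add_of_nonneg_right dist_nonneg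
    · exact h2 x z
    · exact le_add_of_nonneg_left dist_nonneg
    · exact dist_triangle x y z

theorem isometry_inl : Isometry (inl : M → WithSeeds M) := Isometry.of_dist_eq fun _ _ => rfl

theorem isometry_inr : Isometry (inr : Seeds → WithSeeds M) := Isometry.of_dist_eq fun _ _ => rfl

instance : IsUnitBounded (WithSeeds M) where
  dist_le_one := by
    rintro (x | x) (y | y)
    · exact IsUnitBounded.dist_le_one x y
    · exact le_rfl
    · exact le_rfl
    · exact BoundedSigma.dist_le_one x y

theorem exists_dense {D : Set M} (hD : Dense D) :
    ∃ D' : Set (WithSeeds M), Dense D' ∧ #D' ≤ max #D ℵ₀ := by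
  obtain ⟨E, hE, hdense⟩ := Seeds.exists_countable_dense
  refine ⟨inl '' D ∪ inr '' E, ?_, ?_⟩
  · rintro (x | x)
    · exact closure_mono Set.subset_union_left
        (image_closure_subset_closure_image isometry_inl.continuous ⟨x, hD x, rfl⟩)
    · exact closure_mono Set.subset_union_right
        (image_closure_subset_closure_image isometry_inr.continuous ⟨x, hdense x, rfl⟩)
  · refine (mk_union_le _ _).trans ((add_le_add mk_image_le
      (hE.image _).le_aleph0).trans ?_)
    exact (add_le_max _ _).trans (max_le le_rfl (le_max_right _ _))

/-- Extension of isometries of `M` by the identity. -/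
def extend : (M ≃ᵢ M) →* (WithSeeds M ≃ᵢ WithSeeds M) where
  toFun e :=
    { toEquiv := Equiv.sumCongr e.toEquiv (Equiv.refl Seeds)
      isometry_toFun := Isometry.of_dist_eq <| by
        rintro (x | x) (y | y)
        · exact e.dist_eq x y
        · rfl
        · rfl
        · rfl }
  map_one' := by
    ext (x | x) <;> rfl
  map_mul' e e' := by
    ext (x | x) <;> rfl

theorem extend_inl (e : M ≃ᵢ M) (x : M) : extend e (inl x) = inl (e x) := rfl

end WithSeeds

theorem continuous_extend_withSeeds {M : Type u} [MetricSpace M] [IsUnitBounded M]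
    (x : WithSeeds M) : Continuous fun e : M ≃ᵢ M => WithSeeds.extend e x := by
  rcases x with x | x
  · exact WithSeeds.isometry_inl.continuous.comp
      ((continuous_apply x).comp continuous_induced_dom)
  · exact continuous_const

/-! ### The hull of `M` with seeds. -/

namespace HomogeneousHull

variable (M : Type u) [MetricSpace M] [IsUnitBounded M]

/-- The seeds inside the hull. -/
noncomputable def seed (s : Seeds) : HomogeneousHull (WithSeeds M) := incl (WithSeeds.inr s)

theorem isometry_seed : Isometry (seed M) :=
  Isometry.of_dist_eq fun x y => (dist_incl _ _).trans (WithSeeds.isometry_inr.dist_eq x y)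

theorem ediam_le_one {X : Type u} [PseudoMetricSpace X] (h : ∀ x y : X, dist x y ≤ 1) :
    Metric.ediam (Set.univ : Set X) ≤ 1 :=
  Metric.ediam_le fun x _ y _ => by
    rw [edist_dist, ENNReal.ofReal_le_one]
    exact h x y

theorem isUrysohn : IsUrysohn (HomogeneousHull (WithSeeds M)) := by
  refine ⟨le_antisymm (ediam_le_one dist_le_one) ?_, fun F _ _ hF K f hf => ?_⟩
  · let s : Seeds := ⟨0, fun _ => 0⟩
    let t : Seeds := ⟨1, fun _ => 0⟩
    have hst : dist s t = 1 := BoundedSigma.dist_ne (by decide)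
    have h := Metric.edist_le_ediam_of_mem (Set.mem_univ (seed M s)) (Set.mem_univ (seed M t))
    rwa [(isometry_seed M).edist_eq, edist_dist, hst, ENNReal.ofReal_one] at h
  · have hd : ∀ x y : F, dist x y ≤ 1 := fun x y => by
      have h := (Metric.edist_le_ediam_of_mem (Set.mem_univ x) (Set.mem_univ y)).trans hF
      rwa [edist_dist, ENNReal.ofReal_le_one] at h
    obtain ⟨j, hj⟩ := Seeds.exists_isometry F hd
    have hj' : Isometry (seed M ∘ j) := (isometry_seed M).comp hj
    have hK : Isometry fun k : K => seed M (j k) := hj'.comp isometry_subtype_coe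
    -- Homogeneity supplies an isometry of the hull moving the seed copy of K onto the range of f;
    -- it carries the seed copy of all of F along.
    obtain ⟨g, hg⟩ := isOmegaHomogeneous (Set.range fun k : K => seed M (j k)) (Set.range f)
      (Set.finite_range _) (Set.finite_range _)
      (hK.isometryEquivOnRange.symm.trans hf.isometryEquivOnRange)
    refine ⟨fun x => g (seed M (j x)), g.isometry.comp hj', fun k => ?_⟩
    have h := hg (hK.isometryEquivOnRange k)
    rw [IsometryEquiv.trans_apply, IsometryEquiv.symm_apply_apply] at h
    exact h

/-- The embedding of `M` in the hull. -/
noncomputable def embed (x : M) : HomogeneousHull (WithSeeds M) := incl (WithSeeds.inl x)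

theorem isometry_embed : Isometry (embed M) :=
  Isometry.of_dist_eq fun x y => (dist_incl _ _).trans (WithSeeds.isometry_inl.dist_eq x y)

theorem isGEmbedding_embed : IsGEmbedding (embed M) := by
  refine ⟨isometry_embed M, extend.comp WithSeeds.extend, ?_, fun φ x => ?_⟩
  · exact continuous_induced_rng.2
      (continuous_pi fun y => continuous_extend_apply continuous_extend_withSeeds y)
  · exact (extend_incl _ _).trans (congrArg incl (WithSeeds.extend_inl φ x))

/-- The upper bound counts terms over a dense set. Below, the hull contains `M`, and its infinitely
many seeds force an infinite base. -/
theorem topWeight_eq : topWeight (HomogeneousHull (WithSeeds M)) = max (topWeight M) ℵ₀ := by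
  refine le_antisymm ?_ (max_le ?_ ?_)
  · obtain ⟨D, hD, hcard⟩ := exists_dense_mk_le_topWeight M
    obtain ⟨D', hD', hcard'⟩ := WithSeeds.exists_dense hD
    exact (HomogeneousHull.topWeight_le hD').trans
      (max_le (hcard'.trans (max_le_max_right _ hcard)) (le_max_right _ _))
  · exact topWeight_le_of_isInducing (isometry_embed M).isUniformInducing.isInducing
  · have : Infinite (HomogeneousHull (WithSeeds M)) := by
      refine Infinite.of_injective (fun n : ℕ => seed M ⟨n, fun _ => 0⟩) fun n m h => ?_
      by_contra hne
      have h1 : dist (seed M ⟨n, fun _ => 0⟩) (seed M ⟨m, fun _ => 0⟩) = 0 :=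
        dist_eq_zero.2 h
      rw [(isometry_seed M).dist_eq, BoundedSigma.dist_ne hne] at h1
      exact one_ne_zero h1
    exact aleph0_le_topWeight _

end HomogeneousHull

theorem mainTheorem7 (M : Type u) [MetricSpace M]
    (hM : Metric.ediam (Set.univ : Set M) ≤ 1) :
    ∃ (L : Type u) (_ : MetricSpace L) (i : M → L),
      CompleteSpace L ∧ IsOmegaHomogeneous L ∧ IsUrysohn L ∧
        topWeight L = max (topWeight M) ℵ₀ ∧
        (Infinite M → topWeight L = topWeight M) ∧ IsGEmbedding i := by
  have : IsUnitBounded M := ⟨fun x y => by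
    have h := (Metric.edist_le_ediam_of_mem (Set.mem_univ x) (Set.mem_univ y)).trans hM
    rwa [edist_dist, ENNReal.ofReal_le_one] at h⟩
  refine ⟨HomogeneousHull (WithSeeds M), inferInstance, HomogeneousHull.embed M, inferInstance,
    HomogeneousHull.isOmegaHomogeneous, HomogeneousHull.isUrysohn M,
    HomogeneousHull.topWeight_eq M, fun _ => ?_, HomogeneousHull.isGEmbedding_embed M⟩
  rw [HomogeneousHull.topWeight_eq]
  exact max_eq_left (aleph0_le_topWeight M)
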